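/- Let $n\in\mathbb{N}$ and let $k\ge 0$ be an integer with $k<n$. Let $P=\{x\in\mathbb{R}^n : a_i^\top x\ge b_i,\ i=1,\dots,m\}\subseteq[0,1]^n$ be a polytope whose description explicitly contains the inequalities $0\le x_j\le 1$ for $j\in[n]=\{1,\dots,n\}$. Suppose that $P\cap\mathbb{Z}^n=\emptyset$ and that there is a group $G$ of permutations of $[n]$ such that $\pi(P)=P$ for all $\pi\in G$, where $\pi x=(x_{\pi^{-1}(1)},\dots,x_{\pi^{-1}(n)})$, and such that $G$ is $(k+1)$-transitive, i.e. any $(k+1)$-tuple of distinct elements of $[n]$ can be mapped to any other one by an element of $G$. Then the following statements are equivalent: (A) $P$ intersects every $(n-k)$-dimensional face of $[0,1]^n$; (B) $\mathrm{SA}^k(P)\neq\emptyset$; (C) $\mathrm{LS}^k(P)\neq\emptyset$; (D) $\mathrm{LS}_0^k(P)\neq\emptyset$. Here the operators are defined as follows. Sherali–Adams: $\mathrm{SA}^k(P)$ is the set of $x\in\mathbb{R}^n$ for which there are reals $y_I$ ($I\subseteq[n]$, $|I|\le k+1$) with $y_\emptyset=1$ and $y_{\{i\}}=x_i$ for all $i\in[n]$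 such that, for every $i\in[m]$ and all disjoint $J_0,J_1\subseteq[n]$ with $|J_0\cup J_1|=k$, the inequality $\prod_{j\in J_1}x_j\prod_{j\in J_0}(1-x_j)\,(a_i^\top x-b_i)\ge 0$ becomes true for $y$ after expanding the left-hand side, reducing with $x_j^2=x_j$, and replacing every monomial $\prod_{j\in I}x_j$ by $y_I$. Lovász–Schrijver: for $Q\subseteq\mathbb{R}^n$ let $K(Q)=\{(\lambda,\lambda x):\lambda\ge 0,\ x\in Q\}\subseteq\mathbb{R}^{n+1}$. Then $\mathrm{LS}(Q)$ is the set of $x\in\mathbb{R}^n$ for which there is a symmetric real matrix $Y$, with rows and columns indexed by $0,1,\dots,n$, such that $Ye_0=Y^\top e_0=\mathrm{diag}(Y)=(1,x)^\top$ and $Ye_i,\ Y(e_0-e_i)\in K(Q)$ for all $i\in[n]$. $\mathrm{LS}^k$ denotes the $k$-fold iterate of $\mathrm{LS}$ (with $\mathrm{LS}^0(P)=P$). Lift-and-Project: $\mathrm{LS}_0(Q)=\bigcap_{i\in[n]}\mathrm{conv}\big((Q\cap\{x_i=1\})\cup(Q\cap\{x_i=0\})\big)$, and $\mathrm{LS}_0^k$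 denotes its $k$-fold iterate (with $\mathrm{LS}_0^0(P)=P$). -/

import Mathlib

open scoped Matrix

noncomputable section

namespace LPHierarchies

variable {n m : ℕ}

/-- The polyhedron `{x ∈ ℝⁿ : a_iᵀ x ≥ b_i for all i}`, where `a_i` is the `i`-th row of `A`. -/
def polyhedron (A : Matrix (Fin m) (Fin n) ℝ) (b : Fin m → ℝ) : Set (Fin n → ℝ) :=
  {x | ∀ i, b i ≤ A i ⬝ᵥ x}

/-- The system `A x ≥ b` explicitly contains all the inequalities `x_j ≥ 0` and `-x_j ≥ -1`,
i.e. `0 ≤ x ≤ 1`.  In particular `polyhedron A b` is then a polytope contained in `[0,1]ⁿ`. -/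
def ContainsBox (A : Matrix (Fin m) (Fin n) ℝ) (b : Fin m → ℝ) : Prop :=
  ∀ j : Fin n, (∃ i, A i = Pi.single j 1 ∧ b i = 0) ∧ (∃ i, A i = -Pi.single j 1 ∧ b i = -1)

/-- `P` contains no integer point. -/
def IntegerEmpty (P : Set (Fin n → ℝ)) : Prop :=
  ∀ x ∈ P, ¬ ∃ z : Fin n → ℤ, ∀ i, x i = (z i : ℝ)

/-- The action of a permutation on `ℝⁿ`, `(π x)_i = x_{π⁻¹(i)}`. -/
def permute (π : Equiv.Perm (Fin n)) (x : Fin n → ℝ) : Fin n → ℝ :=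
  fun i => x (π⁻¹ i)

/-- `P` is invariant under the permutation group `G`: `π(P) = P` for all `π ∈ G`. -/
def Invariant (G : Subgroup (Equiv.Perm (Fin n))) (P : Set (Fin n → ℝ)) : Prop :=
  ∀ π ∈ G, permute π '' P = P

/-- `P` is `r`-transitive: it is invariant under some permutation group on `n` indices that maps
any `r`-tuple of distinct indices to any other one. -/
def Transitive (r : ℕ) (P : Set (Fin n → ℝ)) : Prop :=
  ∃ G : Subgroup (Equiv.Perm (Fin n)),
    MulAction.IsMultiplyPretransitive G (Fin n) r ∧ Invariant G P

/-- The face `{x ∈ [0,1]ⁿ : x_i = 1 for i ∈ S₁, x_i = 0 for i ∈ S₀}` of the hypercube.  For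
disjoint `S₀, S₁` its dimension is `n - (|S₀| + |S₁|)`. -/
def cubeFace (S₀ S₁ : Finset (Fin n)) : Set (Fin n → ℝ) :=
  {x | (∀ i, 0 ≤ x i ∧ x i ≤ 1) ∧ (∀ i ∈ S₁, x i = 1) ∧ ∀ i ∈ S₀, x i = 0}

/-- `P` intersects every face of `[0,1]ⁿ` of codimension `k` (that is, of dimension `n - k`, for
`k ≤ n`). -/
def MeetsFaces (k : ℕ) (P : Set (Fin n → ℝ)) : Prop :=
  ∀ S₀ S₁ : Finset (Fin n), Disjoint S₀ S₁ → S₀.card + S₁.card = k →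
    (P ∩ cubeFace S₀ S₁).Nonempty

/-! ### Sherali–Adams -/

/-- Multilinearization and linearization of a polynomial: each monomial `∏ x_i ^ e_i` is replaced
by `y_I`, where `I = {i : e_i ≠ 0}`, and this is extended linearly. -/
def linearize (y : Finset (Fin n) → ℝ) : MvPolynomial (Fin n) ℝ →ₗ[ℝ] ℝ :=
  (MvPolynomial.basisMonomials (Fin n) ℝ).constr ℝ fun e => y e.support

open MvPolynomial in
/-- The polynomial `∏_{i ∈ J₁} x_i · ∏_{j ∈ J₀} (1 - x_j) · (aᵀ x - β)`. -/
def extendedRow (J₀ J₁ : Finset (Fin n)) (a : Fin n → ℝ) (β : ℝ) : MvPolynomial (Fin n) ℝ :=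
  (∏ i ∈ J₁, X i) * (∏ j ∈ J₀, (1 - X j)) * ((∑ j, C (a j) * X j) - C β)

/-- The lifted relaxation `Mᵏ`.  Only the coordinates `y_I` with `|I| ≤ k + 1` occur in the
constraints; the remaining coordinates of `y` are unconstrained dummies. -/
def saLift (k : ℕ) (A : Matrix (Fin m) (Fin n) ℝ) (b : Fin m → ℝ) :
    Set (Finset (Fin n) → ℝ) :=
  {y | y ∅ = 1 ∧ ∀ (i : Fin m) (J₀ J₁ : Finset (Fin n)), Disjoint J₀ J₁ → (J₀ ∪ J₁).card = k →
    0 ≤ linearize y (extendedRow J₀ J₁ (A i) (b i))}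

/-- The Sherali–Adams relaxation `SAᵏ` of the polytope described by `A x ≥ b`. -/
def SA (k : ℕ) (A : Matrix (Fin m) (Fin n) ℝ) (b : Fin m → ℝ) : Set (Fin n → ℝ) :=
  {x | ∃ y ∈ saLift k A b, ∀ i, y {i} = x i}

/-! ### Lovász–Schrijver -/

/-- The cone `K(P) = {(t, t x) : t ≥ 0, x ∈ P}` in `ℝ^{n+1}`. -/
def coneOver (P : Set (Fin n → ℝ)) : Set (Fin (n + 1) → ℝ) :=
  {v | ∃ t : ℝ, 0 ≤ t ∧ ∃ x ∈ P, v = Fin.cons t (t • x)}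

/-- The `i`-th canonical vector of `ℝ^{n+1}`. -/
def stdVec (i : Fin (n + 1)) : Fin (n + 1) → ℝ := Pi.single i 1

/-- The Lovász–Schrijver operator. -/
def LS (P : Set (Fin n → ℝ)) : Set (Fin n → ℝ) :=
  {x | ∃ Y : Matrix (Fin (n + 1)) (Fin (n + 1)) ℝ,
    Y.IsSymm ∧
    (∀ i : Fin n, Y *ᵥ stdVec i.succ ∈ coneOver P ∧
      Y *ᵥ (stdVec 0 - stdVec i.succ) ∈ coneOver P) ∧
    Y *ᵥ stdVec 0 = Fin.cons 1 x ∧ Yᵀ *ᵥ stdVec 0 = Fin.cons 1 x ∧ Y.diag = Fin.cons 1 x}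

/-! ### Lift-and-Project -/

/-- The Lift-and-Project closure
`LS₀(P) = ⋂_i conv((P ∩ {x_i = 1}) ∪ (P ∩ {x_i = 0}))`. -/
def LS₀ (P : Set (Fin n → ℝ)) : Set (Fin n → ℝ) :=
  ⋂ i : Fin n, convexHull ℝ ((P ∩ {x | x i = 1}) ∪ (P ∩ {x | x i = 0}))

end LPHierarchies

end

/-!
A vector `y` feasible for Sherali–Adams is a pseudo-distribution on `0/1` points, with `linearize y`
as its expectation; `faceMonomial J₀ J₁` is the indicator of a face of the cube.  The four
conditions are shown equivalent in a cycle.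

*Faces to Sherali–Adams.*  Averaging a point of `P` on a face over the permutations that fix the
face pointwise makes its free coordinates equal, by `(k + 1)`-transitivity, and the common value
`c s` can be chosen to depend only on the number `s` of coordinates fixed to `1`
(`MeetsFaces.exists_symmetricPoint`).  It lies strictly between `0` and `1` because `P` has no
integer points.  Hence there is an exchangeable distribution on `k + 1` coordinates in which, given
`s` ones among `k` coordinates, the remaining one is a one with probability `c s`: the mass of a
pattern with `s` ones is proportional to `∏_{j < s} c j / (1 - c j)`.  Its moments form a
Sherali–Adams solution, as each lifted row is a nonnegative multiple of the corresponding row of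
`P` at a symmetric point (`SA_nonempty_of_symmetricPoint_mem`).

*Sherali–Adams to Lovász–Schrijver.*  The conditional second moments of `y` on a face form a
Lovász–Schrijver matrix, whose columns are moment vectors of faces with one more fixed coordinate;
induction gives `SAᵏ ⊆ LSᵏ` (`SA_subset_iterate_LS`).

*Lovász–Schrijver to Lift-and-Project.*  `LS ⊆ LS₀`, since the columns `Y e_i` and `Y (e_0 - e_i)`
exhibit `x` as the required convex combination (`LS_subset_LS₀`).

*Lift-and-Project to faces.*  Every point of an iterate lies in `P`, so it has a fractional
coordinate, and one round allows this coordinate to be fixed to either value.  After `k` rounds a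
face with any prescribed number of zeros and ones meets `P`, and transitivity moves it to every
other face of the same type (`meetsFaces_of_iterate_LS₀_nonempty`).
-/

open scoped Matrix

noncomputable section

namespace LPHierarchies

variable {n m : ℕ}

/-! ### Linearization modulo `x_j² = x_j` -/

open MvPolynomial

/-- The multiplier `∏_{i ∈ J₁} x_i · ∏_{j ∈ J₀} (1 - x_j)`, which on `0/1` points is the indicator
of the face `x_{J₁} = 1`, `x_{J₀} = 0`. -/
def faceMonomial (J₀ J₁ : Finset (Fin n)) : MvPolynomial (Fin n) ℝ :=
  (∏ i ∈ J₁, X i) * (∏ j ∈ J₀, (1 - X j))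

lemma linearize_monomial (y : Finset (Fin n) → ℝ) (e : Fin n →₀ ℕ) (c : ℝ) :
    linearize y (monomial e c) = c * y e.support := by
  have h : (monomial e c : MvPolynomial (Fin n) ℝ) = c • basisMonomials (Fin n) ℝ e := by
    simp [smul_monomial]
  rw [h, map_smul, linearize, Module.Basis.constr_basis, smul_eq_mul]

lemma linearize_one (y : Finset (Fin n) → ℝ) : linearize y 1 = y ∅ := by
  have := linearize_monomial y 0 1
  simpa using this

lemma linearize_C_mul (y : Finset (Fin n) → ℝ) (c : ℝ) (p : MvPolynomial (Fin n) ℝ) :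
    linearize y (C c * p) = c * linearize y p := by
  rw [C_mul', map_smul, smul_eq_mul]

lemma linearize_X_mul_X_mul (y : Finset (Fin n) → ℝ) (j : Fin n) (p : MvPolynomial (Fin n) ℝ) :
    linearize y (X j * (X j * p)) = linearize y (X j * p) := by
  induction p using MvPolynomial.induction_on' with
  | monomial e c =>
    have h : (X j : MvPolynomial (Fin n) ℝ) = monomial (Finsupp.single j 1) 1 := rfl
    rw [h, monomial_mul, monomial_mul, linearize_monomial, linearize_monomial]
    congr 2
    · ring
    · ext i
      by_cases hi : j = i <;> simp [hi]
  | add p q hp hq => simp only [mul_add, map_add, hp, hq]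

lemma linearize_prod_X (y : Finset (Fin n) → ℝ) (I : Finset (Fin n)) :
    linearize y (∏ i ∈ I, X i) = y I := by
  have h : (∏ i ∈ I, X i : MvPolynomial (Fin n) ℝ) =
      monomial (∑ i ∈ I, Finsupp.single i 1) 1 := by
    rw [monomial_sum_one]; rfl
  rw [h, linearize_monomial, one_mul]
  congr 1
  ext i
  simp [Finsupp.finsetSum_apply, Finsupp.single_apply]

lemma linearize_X (y : Finset (Fin n) → ℝ) (i : Fin n) : linearize y (X i) = y {i} := by
  simpa using linearize_prod_X y {i}

lemma faceMonomial_empty : faceMonomial (∅ : Finset (Fin n)) ∅ = 1 := by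
  simp [faceMonomial]

lemma faceMonomial_insert_right {J₀ J₁ : Finset (Fin n)} {i : Fin n} (hi : i ∉ J₁) :
    faceMonomial J₀ (insert i J₁) = faceMonomial J₀ J₁ * X i := by
  rw [faceMonomial, faceMonomial, Finset.prod_insert hi]; ring

lemma faceMonomial_insert_left {J₀ J₁ : Finset (Fin n)} {i : Fin n} (hi : i ∉ J₀) :
    faceMonomial (insert i J₀) J₁ = faceMonomial J₀ J₁ * (1 - X i) := by
  rw [faceMonomial, faceMonomial, Finset.prod_insert hi]; ring

lemma linearize_faceMonomial_mul_X_of_mem_right (y : Finset (Fin n) → ℝ)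
    {J₀ J₁ : Finset (Fin n)} {i : Fin n} (hi : i ∈ J₁) (q : MvPolynomial (Fin n) ℝ) :
    linearize y (faceMonomial J₀ J₁ * X i * q) = linearize y (faceMonomial J₀ J₁ * q) := by
  have h : faceMonomial J₀ J₁ =
      X i * ((∏ j ∈ J₁.erase i, X j) * (∏ j ∈ J₀, (1 - X j))) := by
    rw [faceMonomial, ← Finset.mul_prod_erase J₁ _ hi]; ring
  generalize (∏ j ∈ J₁.erase i, X j : MvPolynomial (Fin n) ℝ) * (∏ j ∈ J₀, (1 - X j)) = r at h
  have := linearize_X_mul_X_mul y i (r * q)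
  rw [h]
  convert this using 2 <;> ring

lemma linearize_faceMonomial_mul_X_of_mem_left (y : Finset (Fin n) → ℝ)
    {J₀ J₁ : Finset (Fin n)} {i : Fin n} (hi : i ∈ J₀) (q : MvPolynomial (Fin n) ℝ) :
    linearize y (faceMonomial J₀ J₁ * X i * q) = 0 := by
  have h : faceMonomial J₀ J₁ =
      (1 - X i) * ((∏ j ∈ J₁, X j) * (∏ j ∈ J₀.erase i, (1 - X j))) := by
    rw [faceMonomial, ← Finset.mul_prod_erase J₀ _ hi]; ring
  generalize (∏ j ∈ J₁, X j : MvPolynomial (Fin n) ℝ) * (∏ j ∈ J₀.erase i, (1 - X j)) = r at h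
  have := linearize_X_mul_X_mul y i (r * q)
  rw [h, show (1 - X i) * r * X i * q = X i * (r * q) - X i * (X i * (r * q)) by ring, map_sub,
    this, sub_self]

lemma linearize_extendedRow (y : Finset (Fin n) → ℝ) (J₀ J₁ : Finset (Fin n)) (a : Fin n → ℝ)
    (β : ℝ) :
    linearize y (extendedRow J₀ J₁ a β) =
      ∑ j, a j * linearize y (faceMonomial J₀ J₁ * X j) -
        β * linearize y (faceMonomial J₀ J₁) := by
  have h : extendedRow J₀ J₁ a β =
      ∑ j, C (a j) * (faceMonomial J₀ J₁ * X j) - C β * faceMonomial J₀ J₁ := by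
    rw [extendedRow, ← faceMonomial, mul_sub, Finset.mul_sum]
    congr 1
    · exact Finset.sum_congr rfl fun j _ => by ring
    · ring
  rw [h, map_sub, map_sum, linearize_C_mul]
  simp_rw [linearize_C_mul]

/-! ### Conditioning a Sherali–Adams solution on a face -/

section Lift

variable {k : ℕ} {A : Matrix (Fin m) (Fin n) ℝ} {b : Fin m → ℝ} {y : Finset (Fin n) → ℝ}

/-- The lifted constraints for multipliers of degree exactly `k` imply those of lower degree,
because `p = p x_j + p (1 - x_j)`. -/
lemma linearize_extendedRow_nonneg (hk : k < n) (hy : y ∈ saLift k A b) (i : Fin m)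
    {J₀ J₁ : Finset (Fin n)} (hd : Disjoint J₀ J₁) (hc : (J₀ ∪ J₁).card ≤ k) :
    0 ≤ linearize y (extendedRow J₀ J₁ (A i) (b i)) := by
  obtain ⟨d, hd'⟩ := Nat.exists_eq_add_of_le hc
  induction d generalizing J₀ J₁ with
  | zero => exact hy.2 i J₀ J₁ hd (by omega)
  | succ d ih =>
    obtain ⟨j, hj⟩ : ∃ j, j ∉ J₀ ∪ J₁ := by
      by_contra! h
      have := Finset.card_le_card (fun j _ => h j : (Finset.univ : Finset (Fin n)) ⊆ _)
      rw [Finset.card_univ, Fintype.card_fin] at this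
      omega
    have hc' : (insert j (J₀ ∪ J₁)).card = (J₀ ∪ J₁).card + 1 := Finset.card_insert_of_notMem hj
    simp only [Finset.mem_union, not_or] at hj
    have h0 := ih (J₀ := insert j J₀) (J₁ := J₁)
      (by rw [Finset.disjoint_insert_left]; exact ⟨hj.2, hd⟩)
      (by rw [Finset.insert_union]; omega) (by rw [Finset.insert_union]; omega)
    have h1 := ih (J₀ := J₀) (J₁ := insert j J₁)
      (by rw [Finset.disjoint_insert_right]; exact ⟨hj.1, hd⟩)
      (by rw [Finset.union_insert]; omega) (by rw [Finset.union_insert]; omega)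
    have h : extendedRow J₀ J₁ (A i) (b i) =
        extendedRow (insert j J₀) J₁ (A i) (b i) + extendedRow J₀ (insert j J₁) (A i) (b i) := by
      simp only [extendedRow]
      rw [Finset.prod_insert hj.1, Finset.prod_insert hj.2]; ring
    rw [h, map_add]
    exact add_nonneg h0 h1

lemma linearize_faceMonomial_mul_X_mem_Icc (hk : k < n) (hbox : ContainsBox A b)
    (hy : y ∈ saLift k A b) (j : Fin n) {J₀ J₁ : Finset (Fin n)} (hd : Disjoint J₀ J₁)
    (hc : (J₀ ∪ J₁).card ≤ k) :
    0 ≤ linearize y (faceMonomial J₀ J₁ * X j) ∧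
      linearize y (faceMonomial J₀ J₁ * X j) ≤ linearize y (faceMonomial J₀ J₁) := by
  obtain ⟨⟨i, hA, hb⟩, ⟨i', hA', hb'⟩⟩ := hbox j
  have h := linearize_extendedRow_nonneg hk hy i hd hc
  have h' := linearize_extendedRow_nonneg hk hy i' hd hc
  rw [linearize_extendedRow, hA, hb] at h
  rw [linearize_extendedRow, hA', hb'] at h'
  simp [Pi.single_apply] at h h'
  exact ⟨h, h'⟩

/-- The conditional expectation of `x` on the face `x_{J₀} = 0`, `x_{J₁} = 1`, for the
pseudo-distribution with moments `y`.  It is meaningful only if the face has positive mass. -/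
def conditionalPoint (y : Finset (Fin n) → ℝ) (J₀ J₁ : Finset (Fin n)) : Fin n → ℝ :=
  fun i => linearize y (faceMonomial J₀ J₁ * X i) / linearize y (faceMonomial J₀ J₁)

lemma conditionalPoint_mem_polyhedron (hk : k < n) (hy : y ∈ saLift k A b)
    {J₀ J₁ : Finset (Fin n)} (hd : Disjoint J₀ J₁) (hc : (J₀ ∪ J₁).card ≤ k)
    (hpos : 0 < linearize y (faceMonomial J₀ J₁)) :
    conditionalPoint y J₀ J₁ ∈ polyhedron A b := by
  intro i
  have h := linearize_extendedRow_nonneg hk hy i hd hc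
  rw [linearize_extendedRow, sub_nonneg] at h
  simp only [dotProduct, conditionalPoint, mul_div_assoc']
  rw [← Finset.sum_div, le_div_iff₀ hpos]
  exact h

/-- The monomials `1, x_1, …, x_n`, indexed like the rows of a Lovász–Schrijver matrix. -/
def homogenizedX (i : Fin (n + 1)) : MvPolynomial (Fin n) ℝ :=
  Fin.cons (α := fun _ => MvPolynomial (Fin n) ℝ) 1 X i

@[simp] lemma homogenizedX_zero : (homogenizedX 0 : MvPolynomial (Fin n) ℝ) = 1 := rfl

@[simp] lemma homogenizedX_succ (i : Fin n) : homogenizedX i.succ = X i := rfl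

lemma smul_mem_coneOver {Q : Set (Fin n → ℝ)} {v : Fin (n + 1) → ℝ} {c : ℝ} (hc : 0 ≤ c)
    (hv : v ∈ coneOver Q) : c • v ∈ coneOver Q := by
  obtain ⟨t, ht, x, hx, rfl⟩ := hv
  refine ⟨c * t, mul_nonneg hc ht, x, hx, ?_⟩
  ext i
  refine Fin.cases ?_ (fun i => ?_) i <;> simp [mul_assoc]

lemma zero_mem_coneOver {Q : Set (Fin n → ℝ)} (hQ : Q.Nonempty) : 0 ∈ coneOver Q := by
  obtain ⟨x, hx⟩ := hQ
  refine ⟨0, le_rfl, x, hx, ?_⟩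
  ext i
  refine Fin.cases ?_ (fun i => ?_) i <;> simp

/-- The moment vector of a face lies in the cone over `Q` as soon as the conditional point of the
face does.  If the face has mass zero, the moment vector vanishes. -/
lemma linearize_mem_coneOver (hk : k < n) (hbox : ContainsBox A b) (hy : y ∈ saLift k A b)
    {Q : Set (Fin n → ℝ)} (hQ : Q.Nonempty) {J₀ J₁ : Finset (Fin n)} (hd : Disjoint J₀ J₁)
    (hc : (J₀ ∪ J₁).card ≤ k)
    (hz : 0 < linearize y (faceMonomial J₀ J₁) → conditionalPoint y J₀ J₁ ∈ Q) :
    (fun a => linearize y (faceMonomial J₀ J₁ * homogenizedX a)) ∈ coneOver Q := by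
  have hle := fun j => linearize_faceMonomial_mul_X_mem_Icc hk hbox hy j hd hc
  have h0 : 0 ≤ linearize y (faceMonomial J₀ J₁) := (hle ⟨k, hk⟩).1.trans (hle ⟨k, hk⟩).2
  rcases h0.eq_or_lt with h0 | h0
  · convert zero_mem_coneOver hQ using 1
    ext a
    refine Fin.cases ?_ (fun j => ?_) a
    · simp [← h0]
    · have := hle j
      rw [← h0] at this
      simpa using le_antisymm this.2 this.1
  · refine ⟨_, h0.le, _, hz h0, ?_⟩
    ext a
    refine Fin.cases ?_ (fun j => ?_) a
    · simp
    · simp [conditionalPoint, mul_div_cancel₀ _ h0.ne']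

/-- Conditioning a degree `k` Sherali–Adams solution on `|J|` coordinates leaves `k - |J|` rounds
of the Lovász–Schrijver operator.  The matrix consists of the second conditional moments; its
columns are the moment vectors of the faces obtained by fixing one more coordinate. -/
lemma conditionalPoint_mem_iterate_LS (hk : k < n) (hbox : ContainsBox A b)
    (hy : y ∈ saLift k A b) (r : ℕ) {J₀ J₁ : Finset (Fin n)} (hd : Disjoint J₀ J₁)
    (hc : (J₀ ∪ J₁).card + r ≤ k) (hpos : 0 < linearize y (faceMonomial J₀ J₁)) :
    conditionalPoint y J₀ J₁ ∈ LS^[r] (polyhedron A b) := by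
  induction r generalizing J₀ J₁ with
  | zero => exact conditionalPoint_mem_polyhedron hk hy hd (by omega) hpos
  | succ r ih =>
    rw [Function.iterate_succ_apply']
    set L := linearize y with hL
    set p := faceMonomial J₀ J₁ with hp
    set Q := LS^[r] (polyhedron A b) with hQdef
    have hQ : Q.Nonempty := ⟨_, ih hd (by omega) hpos⟩
    have hcone : ∀ {J₀ J₁ : Finset (Fin n)}, Disjoint J₀ J₁ → (J₀ ∪ J₁).card + r ≤ k →
        (fun a => L (faceMonomial J₀ J₁ * homogenizedX a)) ∈ coneOver Q := fun hd' hc' =>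
      linearize_mem_coneOver hk hbox hy hQ hd' (by omega) (ih hd' hc')
    have hinv : 0 ≤ (L p)⁻¹ := inv_nonneg.2 hpos.le
    obtain ⟨Y, hY⟩ : ∃ Y : Matrix (Fin (n + 1)) (Fin (n + 1)) ℝ,
        ∀ a c, Y a c = (L p)⁻¹ * L (p * homogenizedX c * homogenizedX a) :=
      ⟨Matrix.of fun _ _ => _, fun _ _ => rfl⟩
    have hsymm : Y.IsSymm := by
      refine Matrix.IsSymm.ext fun a c => ?_
      rw [hY, hY, mul_right_comm]
    have hcol0 : Y *ᵥ stdVec 0 = Fin.cons 1 (conditionalPoint y J₀ J₁) := by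
      ext a
      refine Fin.cases ?_ (fun j => ?_) a
      · simp [stdVec, hY, inv_mul_cancel₀ hpos.ne']
      · simp [stdVec, hY, conditionalPoint, ← hL, ← hp, div_eq_inv_mul]
    refine ⟨Y, hsymm, fun i => ?_, hcol0, by rw [hsymm.eq]; exact hcol0, ?_⟩
    · have hi1 : Y *ᵥ stdVec i.succ = (L p)⁻¹ • fun a => L (p * X i * homogenizedX a) := by
        ext a; simp [stdVec, hY]
      have hi0 : Y *ᵥ (stdVec 0 - stdVec i.succ) =
          (L p)⁻¹ • fun a => L (p * (1 - X i) * homogenizedX a) := by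
        ext a
        rw [Matrix.mulVec_sub, hi1]
        simp [stdVec, hY, mul_sub, sub_mul]
      rw [hi1, hi0]
      suffices h : (fun a => L (p * X i * homogenizedX a)) ∈ coneOver Q ∧
          (fun a => L (p * (1 - X i) * homogenizedX a)) ∈ coneOver Q from
        ⟨smul_mem_coneOver hinv h.1, smul_mem_coneOver hinv h.2⟩
      by_cases h1 : i ∈ J₁
      · have e : ∀ q, L (p * X i * q) = L (p * q) :=
          linearize_faceMonomial_mul_X_of_mem_right y h1
        constructor
        · simp_rw [e]
          exact hcone hd (by omega)
        · simp_rw [mul_sub, sub_mul, map_sub, e, mul_one, sub_self]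
          exact zero_mem_coneOver hQ
      by_cases h0 : i ∈ J₀
      · have e : ∀ q, L (p * X i * q) = 0 := linearize_faceMonomial_mul_X_of_mem_left y h0
        constructor
        · simp_rw [e]
          exact zero_mem_coneOver hQ
        · simp_rw [mul_sub, sub_mul, map_sub, e, mul_one, sub_zero]
          exact hcone hd (by omega)
      have hcard : (insert i (J₀ ∪ J₁)).card = (J₀ ∪ J₁).card + 1 :=
        Finset.card_insert_of_notMem (by simp [h0, h1])
      rw [← faceMonomial_insert_right h1, ← faceMonomial_insert_left h0]
      exact ⟨hcone (Finset.disjoint_insert_right.2 ⟨h0, hd⟩)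
          (by rw [Finset.union_insert]; omega),
        hcone (Finset.disjoint_insert_left.2 ⟨h1, hd⟩) (by rw [Finset.insert_union]; omega)⟩
    · ext a
      refine Fin.cases ?_ (fun j => ?_) a
      · simp [hY, inv_mul_cancel₀ hpos.ne']
      · have e : L (p * X j * X j) = L (p * X j) := by
          have := linearize_X_mul_X_mul y j p
          rw [hL]
          convert this using 2 <;> ring
        simp [hY, e, conditionalPoint, ← hL, ← hp, div_eq_inv_mul]

lemma SA_subset_iterate_LS (hk : k < n) (hbox : ContainsBox A b) :
    SA k A b ⊆ LS^[k] (polyhedron A b) := by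
  rintro x ⟨y, hy, hx⟩
  have h1 : linearize y (faceMonomial ∅ ∅) = 1 := by
    rw [faceMonomial_empty, linearize_one, hy.1]
  have h := conditionalPoint_mem_iterate_LS hk hbox hy k (Finset.disjoint_empty_left ∅)
    (by simp) (h1.symm ▸ one_pos)
  convert h
  ext i
  rw [conditionalPoint, h1, div_one, faceMonomial_empty, one_mul, linearize_X, hx]

end Lift

/-! ### Lovász–Schrijver is at least as strong as Lift-and-Project -/

lemma LS_subset_LS₀ (Q : Set (Fin n → ℝ)) : LS Q ⊆ LS₀ Q := by
  rintro x ⟨Y, hsymm, hcone, hcol, -, hdiag⟩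
  refine Set.mem_iInter.2 fun i => ?_
  obtain ⟨⟨t, ht, u, hu, hYu⟩, ⟨s, hs, v, hv, hYv⟩⟩ := hcone i
  rw [Matrix.mulVec_sub, hYu, hcol] at hYv
  have h0i : t = x i := by
    have h1 := congrFun hYu 0
    have h2 := congrFun hcol i.succ
    have h3 := congrFun (congrFun hsymm 0) i.succ
    simp only [stdVec, Matrix.mulVec_single_one, Matrix.col_apply, Fin.cons_zero, Fin.cons_succ,
      Matrix.transpose_apply] at h1 h2 h3
    rw [← h1, ← h2, h3]
  have hii : t * u i = x i := by
    have h1 := congrFun hYu i.succ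
    have h2 := congrFun hdiag i.succ
    simp only [stdVec, Matrix.mulVec_single_one, Matrix.col_apply, Fin.cons_succ,
      Matrix.diag_apply, Pi.smul_apply, smul_eq_mul] at h1 h2
    rw [← h1, ← h2]
  have hts : t + s = 1 := by
    have := congrFun hYv 0
    simp at this
    linarith
  have hx : ∀ j, x j = t * u j + s * v j := fun j => by
    have := congrFun hYv j.succ
    simp at this
    linarith
  have hxe : x = t • u + s • v := by ext j; simp [hx j]
  have hvi : s * v i = 0 := by linarith [hx i]
  have hui : t * (u i - 1) = 0 := by linarith
  -- A cone element with scale `0` carries no information on its base point, so the two degenerate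
  -- scales are treated apart.
  rcases ht.eq_or_lt with rfl | ht
  · obtain rfl : s = 1 := by linarith
    refine subset_convexHull ℝ _ (Or.inr ?_)
    rw [hxe, zero_smul, one_smul, zero_add]
    exact ⟨hv, by simpa using hvi⟩
  rcases hs.eq_or_lt with rfl | hs
  · obtain rfl : t = 1 := by linarith
    refine subset_convexHull ℝ _ (Or.inl ?_)
    rw [hxe, zero_smul, one_smul, add_zero]
    exact ⟨hu, show u i = 1 by linarith⟩
  · rw [hxe]
    have hui' : u i = 1 := sub_eq_zero.1 ((mul_eq_zero.1 hui).resolve_left ht.ne')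
    have hvi' : v i = 0 := (mul_eq_zero.1 hvi).resolve_left hs.ne'
    have hu' : u ∈ (Q ∩ {x | x i = 1}) ∪ (Q ∩ {x | x i = 0}) := Or.inl ⟨hu, hui'⟩
    have hv' : v ∈ (Q ∩ {x | x i = 1}) ∪ (Q ∩ {x | x i = 0}) := Or.inr ⟨hv, hvi'⟩
    exact convex_convexHull ℝ _ (subset_convexHull ℝ _ hu') (subset_convexHull ℝ _ hv')
      ht.le hs.le hts

lemma LS₀_mono {Q R : Set (Fin n → ℝ)} (h : Q ⊆ R) : LS₀ Q ⊆ LS₀ R :=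
  Set.iInter_mono fun _ => convexHull_mono
    (Set.union_subset_union (Set.inter_subset_inter_left _ h) (Set.inter_subset_inter_left _ h))

lemma iterate_LS_subset_iterate_LS₀ (r : ℕ) (P : Set (Fin n → ℝ)) : LS^[r] P ⊆ LS₀^[r] P := by
  induction r with
  | zero => exact subset_rfl
  | succ r ih =>
    rw [Function.iterate_succ_apply', Function.iterate_succ_apply']
    exact (LS_subset_LS₀ _).trans (LS₀_mono ih)

/-! ### Fixing coordinates in Lift-and-Project -/

lemma convex_polyhedron (A : Matrix (Fin m) (Fin n) ℝ) (b : Fin m → ℝ) :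
    Convex ℝ (polyhedron A b) := by
  intro x hx y hy s t hs ht hst i
  rw [dotProduct_add, dotProduct_smul, dotProduct_smul, smul_eq_mul, smul_eq_mul]
  calc b i = s * b i + t * b i := by rw [← add_mul, hst, one_mul]
    _ ≤ _ := add_le_add (mul_le_mul_of_nonneg_left (hx i) hs)
      (mul_le_mul_of_nonneg_left (hy i) ht)

lemma mem_Icc_of_mem_polyhedron {A : Matrix (Fin m) (Fin n) ℝ} {b : Fin m → ℝ}
    (hbox : ContainsBox A b) {x : Fin n → ℝ} (hx : x ∈ polyhedron A b) (j : Fin n) :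
    0 ≤ x j ∧ x j ≤ 1 := by
  obtain ⟨⟨i, hA, hb⟩, ⟨i', hA', hb'⟩⟩ := hbox j
  have h := hx i
  have h' := hx i'
  rw [hA, hb] at h
  rw [hA', hb'] at h'
  simp at h h'
  exact ⟨h, h'⟩

lemma iterate_LS₀_subset (hn : 0 < n) {P : Set (Fin n → ℝ)} (hP : Convex ℝ P) (r : ℕ) :
    LS₀^[r] P ⊆ P := by
  induction r with
  | zero => exact subset_rfl
  | succ r ih =>
    rw [Function.iterate_succ_apply']
    refine (Set.iInter_subset _ ⟨0, hn⟩).trans (convexHull_min ?_ hP)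
    exact Set.union_subset (Set.inter_subset_left.trans ih) (Set.inter_subset_left.trans ih)

lemma IntegerEmpty.exists_fractional {P : Set (Fin n → ℝ)} (hP : IntegerEmpty P)
    {x : Fin n → ℝ} (hx : x ∈ P) (hcube : ∀ i, 0 ≤ x i ∧ x i ≤ 1) :
    ∃ i, 0 < x i ∧ x i < 1 := by
  by_contra! h
  refine hP x hx ⟨fun i => if x i = 0 then 0 else 1, fun i => ?_⟩
  by_cases h0 : x i = 0
  · simp [h0]
  · simpa [h0] using le_antisymm (hcube i).2 (h i (lt_of_le_of_ne (hcube i).1 (Ne.symm h0)))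

/-- A convex combination of points of the cube lies on a face only if every point with positive
weight does. -/
lemma exists_mem_cubeFace_of_mem_convexHull {Q : Set (Fin n → ℝ)}
    (hQ : ∀ x ∈ Q, ∀ i, 0 ≤ x i ∧ x i ≤ 1) {S₀ S₁ : Finset (Fin n)} {x : Fin n → ℝ}
    (hx : x ∈ convexHull ℝ Q) (hface : x ∈ cubeFace S₀ S₁) (i : Fin n) :
    (x i < 1 → ∃ z ∈ Q, z ∈ cubeFace S₀ S₁ ∧ z i < 1) ∧
      (0 < x i → ∃ z ∈ Q, z ∈ cubeFace S₀ S₁ ∧ 0 < z i) := by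
  obtain ⟨ι, _, w, z, hw, hw1, hz, hxz⟩ := mem_convexHull_iff_exists_fintype.1 hx
  have hval : ∀ j, ∑ l, w l * z l j = x j := fun j => by rw [← hxz]; simp
  have hval' : ∀ j, ∑ l, w l * (1 - z l j) = 1 - x j := fun j => by
    simp [mul_sub, hval, hw1]
  have hmem : ∀ l, 0 < w l → z l ∈ cubeFace S₀ S₁ := by
    intro l hl
    refine ⟨hQ _ (hz l), fun j hj => ?_, fun j hj => ?_⟩
    · have h := hval' j
      rw [hface.2.1 j hj, sub_self, Finset.sum_eq_zero_iff_of_nonneg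
        fun l _ => mul_nonneg (hw l) (sub_nonneg.2 (hQ _ (hz l) j).2)] at h
      linarith [(mul_eq_zero.1 (h l (Finset.mem_univ l))).resolve_left hl.ne']
    · have h := hval j
      rw [hface.2.2 j hj, Finset.sum_eq_zero_iff_of_nonneg
        fun l _ => mul_nonneg (hw l) (hQ _ (hz l) j).1] at h
      exact (mul_eq_zero.1 (h l (Finset.mem_univ l))).resolve_left hl.ne'
  constructor
  · intro hi
    have h : 0 < ∑ l, w l * (1 - z l i) := by rw [hval']; linarith
    obtain ⟨l, -, hl⟩ := Finset.exists_lt_of_sum_lt (s := Finset.univ) (f := fun _ : ι => (0 : ℝ))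
      (by simpa using h)
    have hwl : 0 < w l := (hw l).lt_of_ne fun h => by simp [← h] at hl
    exact ⟨z l, hz l, hmem l hwl, by linarith [(mul_pos_iff_of_pos_left hwl).1 hl]⟩
  · intro hi
    have h : 0 < ∑ l, w l * z l i := by rw [hval]; exact hi
    obtain ⟨l, -, hl⟩ := Finset.exists_lt_of_sum_lt (s := Finset.univ) (f := fun _ : ι => (0 : ℝ))
      (by simpa using h)
    have hwl : 0 < w l := (hw l).lt_of_ne fun h => by simp [← h] at hl
    exact ⟨z l, hz l, hmem l hwl, (mul_pos_iff_of_pos_left hwl).1 hl⟩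

lemma exists_mem_cubeFace_insert {Q : Set (Fin n → ℝ)} (hQ : ∀ x ∈ Q, ∀ i, 0 ≤ x i ∧ x i ≤ 1)
    {S₀ S₁ : Finset (Fin n)} {x : Fin n → ℝ} (hx : x ∈ LS₀ Q) (hface : x ∈ cubeFace S₀ S₁)
    {i : Fin n} (hi0 : 0 < x i) (hi1 : x i < 1) :
    (Q ∩ cubeFace (insert i S₀) S₁).Nonempty ∧ (Q ∩ cubeFace S₀ (insert i S₁)).Nonempty := by
  have hR : ∀ z ∈ (Q ∩ {x | x i = 1}) ∪ (Q ∩ {x | x i = 0}), ∀ j, 0 ≤ z j ∧ z j ≤ 1 := by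
    rintro z (hz | hz) <;> exact hQ z hz.1
  obtain ⟨h0, h1⟩ := exists_mem_cubeFace_of_mem_convexHull hR (Set.mem_iInter.1 hx i) hface i
  constructor
  · obtain ⟨z, hz | hz, hzf, hzi⟩ := h0 hi1
    · exact absurd hz.2 hzi.ne
    · refine ⟨z, hz.1, hzf.1, hzf.2.1, fun j hj => ?_⟩
      rcases Finset.mem_insert.1 hj with rfl | hj
      exacts [hz.2, hzf.2.2 j hj]
  · obtain ⟨z, hz | hz, hzf, hzi⟩ := h1 hi0
    · refine ⟨z, hz.1, hzf.1, fun j hj => ?_, hzf.2.2⟩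
      rcases Finset.mem_insert.1 hj with rfl | hj
      exacts [hz.2, hzf.2.1 j hj]
    · exact absurd hz.2 hzi.ne'

/-- As every point met along the way has a fractional coordinate, `p + q` rounds allow one to fix
`p` new coordinates to `0` and `q` new coordinates to `1`. -/
lemma exists_mem_cubeFace_of_mem_iterate_LS₀ (hn : 0 < n) {P : Set (Fin n → ℝ)}
    (hconv : Convex ℝ P) (hcube : ∀ x ∈ P, ∀ i, 0 ≤ x i ∧ x i ≤ 1) (hP : IntegerEmpty P)
    (p q : ℕ) {T₀ T₁ : Finset (Fin n)} {x : Fin n → ℝ} (hx : x ∈ LS₀^[p + q] P)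
    (hface : x ∈ cubeFace T₀ T₁) :
    ∃ S₀ S₁ : Finset (Fin n), S₀.card = T₀.card + p ∧ S₁.card = T₁.card + q ∧
      (P ∩ cubeFace S₀ S₁).Nonempty := by
  -- The coordinate may be fixed to either value; the zeros are used up before the ones.
  obtain ⟨r, hr⟩ : ∃ r, r = p + q := ⟨_, rfl⟩
  rw [← hr] at hx
  induction r generalizing p q T₀ T₁ x with
  | zero => exact ⟨T₀, T₁, by omega, by omega, x, hx, hface⟩
  | succ r ih =>
    have hxP := iterate_LS₀_subset hn hconv _ hx
    obtain ⟨i, hi0, hi1⟩ := hP.exists_fractional hxP (hcube x hxP)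
    rw [Function.iterate_succ_apply'] at hx
    have hT₀ : i ∉ T₀ := fun h => hi0.ne' (hface.2.2 i h)
    have hT₁ : i ∉ T₁ := fun h => hi1.ne (hface.2.1 i h)
    obtain ⟨⟨u, hu, huf⟩, ⟨v, hv, hvf⟩⟩ := exists_mem_cubeFace_insert
      (fun x hx => hcube x (iterate_LS₀_subset hn hconv r hx)) hx hface hi0 hi1
    cases p with
    | succ p =>
      obtain ⟨S₀, S₁, h₀, h₁, h⟩ := ih p q huf (hx := hu) (by omega)
      rw [Finset.card_insert_of_notMem hT₀] at h₀
      exact ⟨S₀, S₁, by omega, h₁, h⟩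
    | zero =>
      cases q with
      | zero => omega
      | succ q =>
        obtain ⟨S₀, S₁, h₀, h₁, h⟩ := ih 0 q hvf (hx := hv) (by omega)
        rw [Finset.card_insert_of_notMem hT₁] at h₁
        exact ⟨S₀, S₁, h₀, by omega, h⟩

/-! ### Moving faces by a transitive group -/

lemma disjoint_of_mem_cubeFace {S₀ S₁ : Finset (Fin n)} {x : Fin n → ℝ}
    (hx : x ∈ cubeFace S₀ S₁) : Disjoint S₀ S₁ :=
  Finset.disjoint_left.2 fun i h0 h1 => zero_ne_one ((hx.2.2 i h0).symm.trans (hx.2.1 i h1))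

lemma Invariant.permute_mem {G : Subgroup (Equiv.Perm (Fin n))} {P : Set (Fin n → ℝ)}
    (h : Invariant G P) {π : Equiv.Perm (Fin n)} (hπ : π ∈ G) {x : Fin n → ℝ} (hx : x ∈ P) :
    permute π x ∈ P :=
  h π hπ ▸ Set.mem_image_of_mem _ hx

lemma permute_apply_apply (π : Equiv.Perm (Fin n)) (x : Fin n → ℝ) (i : Fin n) :
    permute π x (π i) = x i := by
  simp [permute]

lemma exists_perm_eq_on {G : Subgroup (Equiv.Perm (Fin n))} {r : ℕ}
    (hG : MulAction.IsMultiplyPretransitive G (Fin n) r) {T : Finset (Fin n)} (hT : T.card = r)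
    {f : Fin n → Fin n} (hf : Set.InjOn f T) : ∃ π ∈ G, ∀ t ∈ T, π t = f t := by
  let e : Fin r ≃ T := (Finset.equivFinOfCardEq hT).symm
  let u : Fin r ↪ Fin n := ⟨fun l => e l, Subtype.val_injective.comp e.injective⟩
  let v : Fin r ↪ Fin n := ⟨fun l => f (e l), fun a c h =>
    e.injective (Subtype.ext (hf (e a).2 (e c).2 h))⟩
  obtain ⟨g, hg⟩ := hG.exists_smul_eq u v
  refine ⟨g, g.2, fun t ht => ?_⟩
  have h : ∀ l, (g : Equiv.Perm (Fin n)) (e l) = f (e l) := fun l => DFunLike.congr_fun hg l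
  simpa using h (e.symm ⟨t, ht⟩)

lemma exists_perm_faces {G : Subgroup (Equiv.Perm (Fin n))} {k : ℕ} (hk : k < n)
    (hG : MulAction.IsMultiplyPretransitive G (Fin n) (k + 1)) {S₀ S₁ T₀ T₁ : Finset (Fin n)}
    (hS : Disjoint S₀ S₁) (hT : Disjoint T₀ T₁) (h₀ : S₀.card = T₀.card) (h₁ : S₁.card = T₁.card)
    (hc : S₀.card + S₁.card = k) :
    ∃ π ∈ G, (∀ i, π i ∈ T₀ ↔ i ∈ S₀) ∧ ∀ i, π i ∈ T₁ ↔ i ∈ S₁ := by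
  have hG' : MulAction.IsMultiplyPretransitive G (Fin n) k :=
    MulAction.isMultiplyPretransitive_of_le (n := k + 1) (Nat.le_succ k)
      (by simpa using hk)
  let e₀ : S₀ ≃ T₀ := Finset.equivOfCardEq h₀
  let e₁ : S₁ ≃ T₁ := Finset.equivOfCardEq h₁
  let f : Fin n → Fin n := fun i =>
    if h : i ∈ S₀ then e₀ ⟨i, h⟩ else if h' : i ∈ S₁ then e₁ ⟨i, h'⟩ else i
  have hf₀ : ∀ i (h : i ∈ S₀), f i = e₀ ⟨i, h⟩ := fun i h => by simp [f, h]
  have hf₁ : ∀ i (h : i ∈ S₁), f i = e₁ ⟨i, h⟩ := fun i h => by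
    simp [f, h, Finset.disjoint_right.1 hS h]
  have hinj : Set.InjOn f (S₀ ∪ S₁ : Finset (Fin n)) := by
    intro i hi j hj hij
    rw [Finset.mem_coe, Finset.mem_union] at hi hj
    rcases hi with hi | hi <;> rcases hj with hj | hj
    · rw [hf₀ i hi, hf₀ j hj] at hij
      exact congrArg Subtype.val (e₀.injective (Subtype.ext hij))
    · rw [hf₀ i hi, hf₁ j hj] at hij
      exact absurd (hij ▸ (e₀ _).2) (Finset.disjoint_right.1 hT (e₁ _).2)
    · rw [hf₁ i hi, hf₀ j hj] at hij
      exact absurd (hij ▸ (e₁ _).2) (Finset.disjoint_left.1 hT (e₀ _).2)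
    · rw [hf₁ i hi, hf₁ j hj] at hij
      exact congrArg Subtype.val (e₁.injective (Subtype.ext hij))
  obtain ⟨π, hπ, hπf⟩ := exists_perm_eq_on hG' (by rw [Finset.card_union_of_disjoint hS, hc]) hinj
  have m₀ : S₀.map π.toEmbedding = T₀ := by
    refine Finset.eq_of_subset_of_card_le (fun j hj => ?_) (by rw [Finset.card_map, h₀])
    obtain ⟨i, hi, rfl⟩ := Finset.mem_map.1 hj
    simp [hπf i (Finset.mem_union_left _ hi), hf₀ i hi]
  have m₁ : S₁.map π.toEmbedding = T₁ := by
    refine Finset.eq_of_subset_of_card_le (fun j hj => ?_) (by rw [Finset.card_map, h₁])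
    obtain ⟨i, hi, rfl⟩ := Finset.mem_map.1 hj
    simp [hπf i (Finset.mem_union_right _ hi), hf₁ i hi]
  exact ⟨π, hπ, fun i => by simp [← m₀], fun i => by simp [← m₁]⟩

lemma meetsFaces_of_iterate_LS₀_nonempty {k : ℕ} (hk : k < n) {P : Set (Fin n → ℝ)}
    (hconv : Convex ℝ P) (hcube : ∀ x ∈ P, ∀ i, 0 ≤ x i ∧ x i ≤ 1) (hP : IntegerEmpty P)
    (hsym : Transitive (k + 1) P) (h : (LS₀^[k] P).Nonempty) : MeetsFaces k P := by
  intro T₀ T₁ hT hc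
  obtain ⟨G, hG, hinv⟩ := hsym
  obtain ⟨x, hx⟩ := h
  have hn : 0 < n := by omega
  rw [← hc] at hx
  obtain ⟨S₀, S₁, h₀, h₁, z, hz, hzf⟩ := exists_mem_cubeFace_of_mem_iterate_LS₀ hn hconv hcube hP
    T₀.card T₁.card (T₀ := ∅) (T₁ := ∅) hx
    ⟨hcube x (iterate_LS₀_subset hn hconv _ hx), by simp, by simp⟩
  rw [Finset.card_empty, zero_add] at h₀ h₁
  obtain ⟨π, hπ, hπ₀, hπ₁⟩ := exists_perm_faces hk hG (disjoint_of_mem_cubeFace hzf) hT h₀ h₁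
    (by omega)
  refine ⟨permute π z, hinv.permute_mem hπ hz, fun i => hzf.1 _, fun i hi => ?_, fun i hi => ?_⟩
  · exact hzf.2.1 _ ((hπ₁ _).1 (by simpa using hi))
  · exact hzf.2.2 _ ((hπ₀ _).1 (by simpa using hi))

/-! ### Symmetric points on faces -/

/-- The point of the face `x_{J₀} = 0`, `x_{J₁} = 1` all of whose other coordinates equal `c`. -/
def symmetricPoint (J₀ J₁ : Finset (Fin n)) (c : ℝ) : Fin n → ℝ :=
  fun i => if i ∈ J₁ then 1 else if i ∈ J₀ then 0 else c

open Classical in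
/-- Averaging a point of a face over the permutations in `G` that fix the face pointwise gives a
symmetric point: by transitivity on the free coordinates these all get the same value. -/
lemma exists_symmetricPoint_mem {G : Subgroup (Equiv.Perm (Fin n))} {k : ℕ} (hk : k < n)
    (hG : MulAction.IsMultiplyPretransitive G (Fin n) (k + 1)) {P : Set (Fin n → ℝ)}
    (hconv : Convex ℝ P) (hinv : Invariant G P) {J₀ J₁ : Finset (Fin n)} (hd : Disjoint J₀ J₁)
    (hc : J₀.card + J₁.card = k) (hface : (P ∩ cubeFace J₀ J₁).Nonempty) :
    ∃ c, symmetricPoint J₀ J₁ c ∈ P := by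
  obtain ⟨x, hx, -, hx₁, hx₀⟩ := hface
  have hcard : (J₀ ∪ J₁).card = k := by rw [Finset.card_union_of_disjoint hd, hc]
  let H : Finset (Equiv.Perm (Fin n)) :=
    Finset.univ.filter fun π => π ∈ G ∧ ∀ t ∈ J₀ ∪ J₁, π t = t
  have hH : ∀ {π}, π ∈ H ↔ π ∈ G ∧ ∀ t ∈ J₀ ∪ J₁, π t = t := by simp [H]
  have h1 : (1 : Equiv.Perm (Fin n)) ∈ H := hH.2 ⟨G.one_mem, fun _ _ => rfl⟩
  have hpos : (0 : ℝ) < H.card := by exact_mod_cast Finset.card_pos.2 ⟨1, h1⟩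
  let z : Fin n → ℝ := ∑ π ∈ H, (H.card : ℝ)⁻¹ • permute π x
  have hz : z ∈ P := by
    refine hconv.sum_mem (fun _ _ => inv_nonneg.2 hpos.le) ?_
      fun π hπ => hinv.permute_mem (hH.1 hπ).1 hx
    rw [Finset.sum_const, nsmul_eq_mul, mul_inv_cancel₀ hpos.ne']
  have hzi : ∀ i, z i = (H.card : ℝ)⁻¹ * ∑ π ∈ H, x (π⁻¹ i) := fun i => by
    simp [z, permute, Finset.mul_sum]
  have hfix : ∀ i ∈ J₀ ∪ J₁, z i = x i := fun i hi => by
    have h : ∀ π ∈ H, x (π⁻¹ i) = x i := fun π hπ => by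
      rw [Equiv.Perm.inv_eq_iff_eq.2 ((hH.1 hπ).2 i hi).symm]
    rw [hzi, Finset.sum_congr rfl h, Finset.sum_const, nsmul_eq_mul,
      inv_mul_cancel_left₀ hpos.ne']
  have hconst : ∀ i ∉ J₀ ∪ J₁, ∀ j ∉ J₀ ∪ J₁, z i = z j := by
    intro i hi j hj
    have hinj : Set.InjOn (fun t => if t = i then j else t)
        (insert i (J₀ ∪ J₁) : Finset (Fin n)) := by
      intro s hs t ht hst
      have hs' : s = i ∨ s ∈ J₀ ∪ J₁ := by simpa using hs
      have ht' : t = i ∨ t ∈ J₀ ∪ J₁ := by simpa using ht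
      by_cases hsi : s = i <;> by_cases hti : t = i
      · rw [hsi, hti]
      · simp only [hsi, hti, if_true, if_false] at hst
        exact absurd (hst ▸ ht'.resolve_left hti) hj
      · simp only [hsi, hti, if_true, if_false] at hst
        exact absurd (hst ▸ hs'.resolve_left hsi) hj
      · simpa only [hsi, hti, if_false] using hst
    obtain ⟨σ, hσ, hσf⟩ := exists_perm_eq_on hG
      (by rw [Finset.card_insert_of_notMem hi, hcard]) hinj
    have hσi : σ i = j := by simpa using hσf i (Finset.mem_insert_self _ _)
    have hσH : σ ∈ H := hH.2 ⟨hσ, fun t ht => by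
      rw [hσf t (Finset.mem_insert_of_mem ht), if_neg (ne_of_mem_of_not_mem ht hi)]⟩
    rw [hzi, hzi]
    congr 1
    refine Finset.sum_bij' (fun π _ => σ * π) (fun π _ => σ⁻¹ * π) ?_ ?_ ?_ ?_ ?_
    · intro π hπ
      refine hH.2 ⟨G.mul_mem hσ (hH.1 hπ).1, fun t ht => ?_⟩
      rw [Equiv.Perm.mul_apply, (hH.1 hπ).2 t ht, (hH.1 hσH).2 t ht]
    · intro π hπ
      refine hH.2 ⟨G.mul_mem (G.inv_mem hσ) (hH.1 hπ).1, fun t ht => ?_⟩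
      rw [Equiv.Perm.mul_apply, (hH.1 hπ).2 t ht, Equiv.Perm.inv_eq_iff_eq, (hH.1 hσH).2 t ht]
    · simp
    · simp
    · intro π hπ
      simp [← hσi]
  obtain ⟨j, hj⟩ : ∃ j, j ∉ J₀ ∪ J₁ := by
    by_contra! h
    have := Finset.card_le_card (fun j _ => h j : (Finset.univ : Finset (Fin n)) ⊆ _)
    rw [Finset.card_univ, Fintype.card_fin] at this
    omega
  refine ⟨z j, ?_⟩
  convert hz
  ext i
  rw [symmetricPoint]
  split_ifs with hi₁ hi₀
  · rw [hfix i (Finset.mem_union_right _ hi₁), hx₁ i hi₁]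
  · rw [hfix i (Finset.mem_union_left _ hi₀), hx₀ i hi₀]
  · exact hconst j hj i (by simp [hi₀, hi₁])

lemma permute_symmetricPoint {π : Equiv.Perm (Fin n)} {S₀ S₁ T₀ T₁ : Finset (Fin n)}
    (h₀ : ∀ i, π i ∈ T₀ ↔ i ∈ S₀) (h₁ : ∀ i, π i ∈ T₁ ↔ i ∈ S₁) (c : ℝ) :
    permute π (symmetricPoint S₀ S₁ c) = symmetricPoint T₀ T₁ c := by
  ext i
  obtain ⟨i, rfl⟩ := π.surjective i
  rw [permute_apply_apply]
  simp [symmetricPoint, h₀, h₁]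

/-- Up to symmetry a face of codimension `k` is determined by the number `s` of coordinates it fixes
to `1`, so one value `c` serves all faces with the same `s`.  It is fractional as `P` has no integer
points. -/
lemma MeetsFaces.exists_symmetricPoint {k : ℕ} (hk : k < n) {P : Set (Fin n → ℝ)}
    (hconv : Convex ℝ P) (hcube : ∀ x ∈ P, ∀ i, 0 ≤ x i ∧ x i ≤ 1) (hP : IntegerEmpty P)
    (hsym : Transitive (k + 1) P) (h : MeetsFaces k P) {s : ℕ} (hs : s ≤ k) :
    ∃ c, 0 < c ∧ c < 1 ∧ ∀ J₀ J₁ : Finset (Fin n), Disjoint J₀ J₁ → J₀.card + J₁.card = k →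
      J₁.card = s → symmetricPoint J₀ J₁ c ∈ P := by
  obtain ⟨G, hG, hinv⟩ := hsym
  obtain ⟨S, -, hS⟩ := Finset.exists_subset_card_eq
    (s := (Finset.univ : Finset (Fin n))) (n := k) (by simpa using hk.le)
  obtain ⟨S₁, hS₁, hS₁c⟩ := Finset.exists_subset_card_eq (s := S) (n := s) (by omega)
  have hd : Disjoint (S \ S₁) S₁ := Finset.sdiff_disjoint
  have hc : (S \ S₁).card + S₁.card = k := by rw [Finset.card_sdiff_add_card_eq_card hS₁, hS]
  obtain ⟨c, hcP⟩ := exists_symmetricPoint_mem hk hG hconv hinv hd hc (h _ _ hd hc)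
  obtain ⟨i, hi0, hi1⟩ := hP.exists_fractional hcP (hcube _ hcP)
  have hic : symmetricPoint (S \ S₁) S₁ c i = c := by
    rw [symmetricPoint] at hi0 hi1 ⊢
    split_ifs at hi0 hi1 ⊢
    · exact absurd hi1 (lt_irrefl _)
    · exact absurd hi0 (lt_irrefl _)
    · rfl
  rw [hic] at hi0 hi1
  refine ⟨c, hi0, hi1, fun J₀ J₁ hJ hJc hJ₁ => ?_⟩
  obtain ⟨π, hπ, hπ₀, hπ₁⟩ := exists_perm_faces hk hG hd hJ (by omega) (by omega) hc
  rw [← permute_symmetricPoint hπ₀ hπ₁]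
  exact hinv.permute_mem hπ hcP

/-! ### An exchangeable Sherali–Adams solution -/

/-- The mass of a pattern of `a` ones and `N - d - a` zeros among `N` coordinates, when each pattern
on all `N` coordinates with `a` ones has mass `r a`; here `d` is the number of free coordinates. -/
def patternMass (r : ℕ → ℝ) : ℕ → ℕ → ℝ
  | 0, a => r a
  | d + 1, a => patternMass r d a + patternMass r d (a + 1)

lemma patternMass_pos {r : ℕ → ℝ} (hr : ∀ a, 0 < r a) (d a : ℕ) : 0 < patternMass r d a := by
  induction d generalizing a with
  | zero => exact hr a
  | succ d ih => exact add_pos (ih a) (ih (a + 1))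

/-- The product `∏_{j < s} c j / (1 - c j)`.  With these as pattern masses on `k + 1` coordinates,
given `s` ones and `k - s` zeros among `k` of them, the last one is a one with probability `c s`. -/
def oddsProduct (c : ℕ → ℝ) : ℕ → ℝ
  | 0 => 1
  | s + 1 => oddsProduct c s * (c s / (1 - c s))

lemma oddsProduct_pos {c : ℕ → ℝ} (h0 : ∀ s, 0 < c s) (h1 : ∀ s, c s < 1) (s : ℕ) :
    0 < oddsProduct c s := by
  induction s with
  | zero => exact one_pos
  | succ s ih => exact mul_pos ih (div_pos (h0 s) (sub_pos.2 (h1 s)))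

lemma oddsProduct_succ {c : ℕ → ℝ} (h1 : ∀ s, c s < 1) (s : ℕ) :
    oddsProduct c (s + 1) = (oddsProduct c s + oddsProduct c (s + 1)) * c s := by
  have : 1 - c s ≠ 0 := (sub_pos.2 (h1 s)).ne'
  rw [oddsProduct]
  field_simp
  ring

/-- The moments of the exchangeable pseudo-distribution on `N` coordinates with pattern masses
`r`, normalized to total mass one.  Only sets of at most `N` coordinates matter. -/
def exchangeableMoments (N : ℕ) (r : ℕ → ℝ) (I : Finset (Fin n)) : ℝ :=
  patternMass r (N - I.card) I.card / patternMass r N 0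

lemma linearize_exchangeableMoments (N : ℕ) (r : ℕ → ℝ) {J₀ J₁ : Finset (Fin n)}
    (hd : Disjoint J₀ J₁) (hc : J₀.card + J₁.card ≤ N) :
    linearize (exchangeableMoments N r) (faceMonomial J₀ J₁) =
      patternMass r (N - (J₀.card + J₁.card)) J₁.card / patternMass r N 0 := by
  induction J₀ using Finset.induction_on generalizing J₁ with
  | empty => simp [faceMonomial, linearize_prod_X, exchangeableMoments]
  | insert i J₀ hi ih =>
    rw [Finset.disjoint_insert_left] at hd
    rw [Finset.card_insert_of_notMem hi] at hc ⊢
    have e0 := ih hd.2 (by omega)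
    have e1 := ih (J₁ := insert i J₁) (Finset.disjoint_insert_right.2 ⟨hi, hd.2⟩)
      (by rw [Finset.card_insert_of_notMem hd.1]; omega)
    rw [Finset.card_insert_of_notMem hd.1] at e1
    obtain ⟨d, hd'⟩ := Nat.exists_eq_add_of_le hc
    rw [show N - (J₀.card + J₁.card) = d + 1 by omega, patternMass] at e0
    rw [show N - (J₀.card + (J₁.card + 1)) = d by omega] at e1
    rw [faceMonomial_insert_left hi, mul_sub, mul_one, map_sub,
      ← faceMonomial_insert_right hd.1, e0, e1,
      show N - (J₀.card + 1 + J₁.card) = d by omega]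
    ring

/-- Choosing the pattern masses so that conditioning on `s` ones among `k` coordinates gives the
remaining coordinates probability `c s`, the conditional points are the symmetric points. -/
lemma SA_nonempty_of_symmetricPoint_mem {k : ℕ} {A : Matrix (Fin m) (Fin n) ℝ} {b : Fin m → ℝ}
    {c : ℕ → ℝ} (h0 : ∀ s, 0 < c s) (h1 : ∀ s, c s < 1)
    (hc : ∀ J₀ J₁ : Finset (Fin n), Disjoint J₀ J₁ → J₀.card + J₁.card = k →
      symmetricPoint J₀ J₁ (c J₁.card) ∈ polyhedron A b) :
    (SA k A b).Nonempty := by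
  set r := oddsProduct c with hr
  have hrpos : ∀ s, 0 < r s := oddsProduct_pos h0 h1
  have hM : 0 < patternMass r (k + 1) 0 := patternMass_pos hrpos _ _
  refine ⟨_, exchangeableMoments (k + 1) r, ⟨?_, fun i J₀ J₁ hd hk => ?_⟩, fun i => rfl⟩
  · simp [exchangeableMoments, div_self hM.ne']
  rw [Finset.card_union_of_disjoint hd] at hk
  have hL := linearize_exchangeableMoments (k + 1) r hd (by omega)
  rw [show k + 1 - (J₀.card + J₁.card) = 0 + 1 by omega] at hL
  rw [patternMass, patternMass, patternMass] at hL
  have hX : ∀ j, linearize (exchangeableMoments (k + 1) r) (faceMonomial J₀ J₁ * MvPolynomial.X j) =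
      linearize (exchangeableMoments (k + 1) r) (faceMonomial J₀ J₁) *
        symmetricPoint J₀ J₁ (c J₁.card) j := by
    intro j
    rw [symmetricPoint]
    split_ifs with hj₁ hj₀
    · simpa using linearize_faceMonomial_mul_X_of_mem_right (exchangeableMoments (k + 1) r) hj₁ 1
    · simpa using linearize_faceMonomial_mul_X_of_mem_left (exchangeableMoments (k + 1) r) hj₀ 1
    · rw [← faceMonomial_insert_right hj₁, linearize_exchangeableMoments (k + 1) r
        (Finset.disjoint_insert_right.2 ⟨hj₀, hd⟩)
        (by rw [Finset.card_insert_of_notMem hj₁]; omega), Finset.card_insert_of_notMem hj₁,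
        show k + 1 - (J₀.card + (J₁.card + 1)) = 0 by omega, hL, patternMass,
        div_mul_eq_mul_div, hr, ← oddsProduct_succ h1]
  have h : linearize (exchangeableMoments (k + 1) r) (extendedRow J₀ J₁ (A i) (b i)) =
      linearize (exchangeableMoments (k + 1) r) (faceMonomial J₀ J₁) *
        (A i ⬝ᵥ symmetricPoint J₀ J₁ (c J₁.card) - b i) := by
    rw [linearize_extendedRow, dotProduct, mul_sub, Finset.mul_sum]
    congr 1
    · exact Finset.sum_congr rfl fun j _ => by rw [hX]; ring
    · ring
  rw [h, hL]
  exact mul_nonneg (div_pos (add_pos (hrpos _) (hrpos _)) hM).le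
    (sub_nonneg.2 (hc J₀ J₁ hd hk i))

end LPHierarchies

end

theorem theorem1 {n k m : ℕ} (hk : k < n)
    (A : Matrix (Fin m) (Fin n) ℝ) (b : Fin m → ℝ) (hbox : LPHierarchies.ContainsBox A b)
    (P : Set (Fin n → ℝ)) (hP : P = LPHierarchies.polyhedron A b)
    (hempty : LPHierarchies.IntegerEmpty P)
    (hsym : LPHierarchies.Transitive (k + 1) P) :
    List.TFAE
      [LPHierarchies.MeetsFaces k P,
        (LPHierarchies.SA k A b).Nonempty,
        (LPHierarchies.LS^[k] P).Nonempty,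
        (LPHierarchies.LS₀^[k] P).Nonempty] := by
  subst hP
  have hconv := LPHierarchies.convex_polyhedron A b
  have hcube := fun x hx => LPHierarchies.mem_Icc_of_mem_polyhedron (x := x) hbox hx
  tfae_have 1 → 2 := fun h => by
    -- Values of `s` above `k` do not occur; `1 / 2` keeps all weights positive.
    have hc : ∀ s, ∃ c : ℝ, 0 < c ∧ c < 1 ∧ (s ≤ k → ∀ J₀ J₁ : Finset (Fin n), Disjoint J₀ J₁ →
        J₀.card + J₁.card = k → J₁.card = s →
          LPHierarchies.symmetricPoint J₀ J₁ c ∈ LPHierarchies.polyhedron A b) := fun s => by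
      by_cases hs : s ≤ k
      · obtain ⟨c, h0, h1, hc⟩ := h.exists_symmetricPoint hk hconv hcube hempty hsym hs
        exact ⟨c, h0, h1, fun _ => hc⟩
      · exact ⟨1 / 2, by norm_num, by norm_num, fun h => absurd h hs⟩
    choose c h0 h1 hc using hc
    exact LPHierarchies.SA_nonempty_of_symmetricPoint_mem h0 h1
      fun J₀ J₁ hd hJ => hc _ (by omega) J₀ J₁ hd hJ rfl
  tfae_have 2 → 3 := fun h => h.mono (LPHierarchies.SA_subset_iterate_LS hk hbox)
  tfae_have 3 → 4 := fun h => h.mono (LPHierarchies.iterate_LS_subset_iterate_LS₀ k _)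
  tfae_have 4 → 1 :=
    LPHierarchies.meetsFaces_of_iterate_LS₀_nonempty hk hconv hcube hempty hsym
  tfae_finish
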